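/- **Theorem 3.6.** Let $q\in[0,1]$ and $p=3/4$, and let $(S_n)_{n\ge 0}$ be the elephant random walk with memory parameter $p$ and first-step parameter $q$. That is, $S_0=0$ and $S_n=X_1+\cdots+X_n$ for $n\ge 1$, where $\mathbb P(X_1=1)=q$, $\mathbb P(X_1=-1)=1-q$ and, for every $n\ge 1$, $X_{n+1}=\alpha_n X_{\beta_n}$ almost surely, where $\mathbb P(\alpha_n=1)=p$, $\mathbb P(\alpha_n=-1)=1-p$, $\beta_n$ is uniformly distributed on $\{1,\dots,n\}$, $\alpha_n$ and $\beta_n$ are independent, and the pair $(\alpha_n,\beta_n)$ is independent of $(X_1,\dots,X_n)$. Then $$\frac{S_n}{\sqrt{n\log n}}\;\xrightarrow[n\to\infty]{\mathcal L}\;\mathcal N(0,1).$$ -/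

import Mathlib

open MeasureTheory ProbabilityTheory Filter

/-- The Rademacher distribution `R(r)` on `ℝ`: mass `r` at `+1` and mass `1 - r` at `-1`
(meant for `0 ≤ r ≤ 1`). -/
noncomputable def rademacher (r : ℝ) : Measure ℝ :=
  ENNReal.ofReal r • Measure.dirac 1 + ENNReal.ofReal (1 - r) • Measure.dirac (-1)

/-- The steps `X 1, X 2, …` (the value `X 0` plays no role) are those of an elephant random walk
with memory parameter `p` and first-step parameter `q`.  The first step has law `R(q)`; for each
time `n ≥ 1`, the elephant chooses a uniform time `β n` in `{1, …, n}` and a sign `α n` of law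
`R(p)`, the sign, the time and the past `(X 1, …, X n)` being independent of one another, and the
next step is `X (n + 1) = α n * X (β n)`. -/
structure IsElephantRandomWalk {Ω : Type*} [MeasurableSpace Ω] (p q : ℝ)
    (X : ℕ → Ω → ℝ) (α : ℕ → Ω → ℝ) (β : ℕ → Ω → ℕ) (μ : Measure Ω) : Prop where
  measurable_step : ∀ n, 1 ≤ n → Measurable (X n)
  measurable_sign : ∀ n, 1 ≤ n → Measurable (α n)
  measurable_time : ∀ n, 1 ≤ n → Measurable (β n)
  law_first : μ.map (X 1) = rademacher q
  law_sign : ∀ n, 1 ≤ n → μ.map (α n) = rademacher p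
  law_time : ∀ n, 1 ≤ n → μ.map (β n) = uniformOn (Set.Icc 1 n)
  indep_sign_time : ∀ n, 1 ≤ n → IndepFun (α n) (β n) μ
  indep_past : ∀ n, 1 ≤ n →
    IndepFun (fun ω ↦ (α n ω, β n ω)) (fun ω (k : Finset.Icc 1 n) ↦ X k ω) μ
  step : ∀ n, 1 ≤ n → ∀ᵐ ω ∂μ, X (n + 1) ω = α n ω * X (β n ω) ω

/-- The position `S n = X 1 + ⋯ + X n` of the walk with steps `X`; in particular `S 0 = 0`
and `S (n + 1) = S n + X (n + 1)`. -/
def walkPosition {Ω : Type*} (X : ℕ → Ω → ℝ) (n : ℕ) (ω : Ω) : ℝ :=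
  ∑ k ∈ Finset.Icc 1 n, X k ω

open scoped Topology

/-! The proof works with characteristic functions and a one-step recursion, without a martingale
limit theorem. For p = 3/4 the conditional mean of the sign X (n+1) given the past is x = S n /
(2n), so E exp(iu S (n+1)) = E[exp(iu S n) (cos u + i x sin u)], and the bracket is exp(iux)
exp(-u²/2) up to u²x²/2 + 65|u|³. The factor exp(iux) turns u into u(1 + 1/(2n)). For u = τ/√(n+1)
this is τ/√n up to an error that stays O(n^(-3/2)) after multiplication by |S n| ≤ n.

Hence, with φ n = E exp(iτ S n / √n), φ (n+1) = exp(-τ²/(2(n+1))) φ n + O(|τ| n^(-3/2)), where the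
term u²x² is controlled by the crude moment bound E (S n)² ≤ 2n√n
(`norm_integral_exp_walkPosition_succ_sub_le`). The Gaussian factors multiply to exp(-τ²(H_n -
1)/2), H_n being the harmonic number, and the errors are summable, so the total error is at most
C|τ| uniformly in n (`norm_integral_exp_walkPosition_sub_le`). Taking τ = t/√(log n), the error
vanishes while τ² H_n → t², and Lévy's continuity theorem concludes. -/

/-! ### Deterministic estimates. -/

/-- The range |y| ≤ 2 accommodates y = u(±1 - x) with |u|, |x| ≤ 1; the constant 8 bounds e². -/
theorem norm_exp_I_mul_sub_taylor_two_le {y : ℝ} (hy : |y| ≤ 2) :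
    ‖Complex.exp (Complex.I * y) - (1 + Complex.I * y - (y : ℂ) ^ 2 / 2)‖ ≤ 8 * |y| ^ 3 := by
  have h := Complex.norm_exp_sub_sum_le_norm_mul_exp (Complex.I * y) 3
  have h2 : Real.exp |y| ≤ 8 := by
    calc Real.exp |y| ≤ Real.exp 2 := Real.exp_le_exp.2 hy
      _ = Real.exp 1 ^ 2 := by rw [← Real.exp_nat_mul]; norm_num
      _ ≤ 2.7182818286 ^ 2 := by gcongr; exact Real.exp_one_lt_d9.le
      _ ≤ 8 := by norm_num
  have e : ∑ m ∈ Finset.range 3, (Complex.I * (y : ℂ)) ^ m / (m.factorial : ℂ) =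
      1 + Complex.I * y - (y : ℂ) ^ 2 / 2 := by
    simp [Finset.sum_range_succ, mul_pow]
    ring
  rw [e] at h
  simp only [norm_mul, Complex.norm_I, one_mul, Complex.norm_real, Real.norm_eq_abs] at h
  nlinarith [pow_nonneg (abs_nonneg y) 3]

/-- The characteristic function of a centred sign of mean `x` is close to a Gaussian one. -/
theorem norm_charFun_centred_sign_sub_le {x u : ℝ} (hx : |x| ≤ 1) (hu : |u| ≤ 1) :
    ‖Complex.exp (Complex.I * (-(u * x) : ℝ)) *
        (Complex.cos u + Complex.I * Complex.sin u * x) - Complex.exp (-(u : ℂ) ^ 2 / 2)‖ ≤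
      u ^ 2 * x ^ 2 / 2 + 65 * |u| ^ 3 := by
  obtain ⟨hx1, hx2⟩ := abs_le.1 hx
  set A : ℝ → ℂ := fun y ↦ Complex.exp (Complex.I * y) - (1 + Complex.I * y - (y : ℂ) ^ 2 / 2)
    with hA
  have hAle : ∀ z : ℝ, |z| ≤ 2 → ‖A (u * z)‖ ≤ 64 * |u| ^ 3 := fun z hz ↦ by
    have hle : |u * z| ≤ 2 * |u| := by
      rw [abs_mul]; nlinarith [abs_nonneg u]
    calc ‖A (u * z)‖ ≤ 8 * |u * z| ^ 3 := norm_exp_I_mul_sub_taylor_two_le (by linarith)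
      _ ≤ 8 * (2 * |u|) ^ 3 := by gcongr
      _ = 64 * |u| ^ 3 := by ring
  have h1 := hAle (1 - x) (abs_le.2 ⟨by linarith, by linarith⟩)
  have h2 := hAle (-(1 + x)) (abs_le.2 ⟨by linarith, by linarith⟩)
  have hgauss : ‖Complex.exp (-(u : ℂ) ^ 2 / 2) - (1 - (u : ℂ) ^ 2 / 2)‖ ≤ |u| ^ 3 := by
    have hu2 : u ^ 2 ≤ 1 := by rw [← sq_abs]; exact pow_le_one₀ (abs_nonneg u) hu
    have h := Real.abs_exp_sub_one_sub_id_le (x := -u ^ 2 / 2)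
      (abs_le.2 ⟨by linarith, by nlinarith [sq_nonneg u]⟩)
    have e : Complex.exp (-(u : ℂ) ^ 2 / 2) - (1 - (u : ℂ) ^ 2 / 2) =
        ((Real.exp (-u ^ 2 / 2) - 1 - (-u ^ 2 / 2) : ℝ) : ℂ) := by
      push_cast; ring
    rw [e, Complex.norm_real, Real.norm_eq_abs]
    refine h.trans ?_
    have : (-u ^ 2 / 2) ^ 2 = |u| ^ 3 * |u| / 4 := by
      rw [show |u| ^ 3 * |u| / 4 = (|u| ^ 2) ^ 2 / 4 by ring, sq_abs]; ring
    rw [this]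
    nlinarith [pow_nonneg (abs_nonneg u) 3]
  -- A sign of mean x, once centred, equals 1 - x with probability (1 + x)/2 and -(1 + x) with
  -- probability (1 - x)/2. Its mean is 0 and its variance 1 - x², so after Taylor expansion only
  -- u²x²/2 separates it from 1 - u²/2.
  have hsplit : Complex.exp (Complex.I * (-(u * x) : ℝ)) *
        (Complex.cos u + Complex.I * Complex.sin u * x) - Complex.exp (-(u : ℂ) ^ 2 / 2) =
      ((1 + x) / 2 : ℝ) * A (u * (1 - x)) + ((1 - x) / 2 : ℝ) * A (u * -(1 + x)) +
        ((u ^ 2 * x ^ 2 / 2 : ℝ) : ℂ) -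
        (Complex.exp (-(u : ℂ) ^ 2 / 2) - (1 - (u : ℂ) ^ 2 / 2)) := by
    have e1 : Complex.exp (Complex.I * (u * (1 - x) : ℝ)) =
        Complex.exp (Complex.I * (-(u * x) : ℝ)) *
          (Complex.cos u + Complex.I * Complex.sin u) := by
      rw [mul_comm Complex.I (Complex.sin _), ← Complex.exp_mul_I, ← Complex.exp_add]
      congr 1; push_cast; ring
    have e2 : Complex.exp (Complex.I * (u * -(1 + x) : ℝ)) =
        Complex.exp (Complex.I * (-(u * x) : ℝ)) *
          (Complex.cos u - Complex.I * Complex.sin u) := by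
      have : Complex.cos u - Complex.I * Complex.sin u = Complex.exp (-u * Complex.I) := by
        rw [Complex.exp_mul_I, Complex.cos_neg, Complex.sin_neg]; ring
      rw [this, ← Complex.exp_add]
      congr 1; push_cast; ring
    simp only [hA, e1, e2]
    push_cast
    linear_combination (0 : ℂ) * Complex.I_sq
  rw [hsplit]
  have hn1 : ‖(((1 + x) / 2 : ℝ) : ℂ) * A (u * (1 - x))‖ ≤ (1 + x) / 2 * (64 * |u| ^ 3) := by
    rw [norm_mul, Complex.norm_real, Real.norm_of_nonneg (by linarith)]
    exact mul_le_mul_of_nonneg_left h1 (by linarith)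
  have hn2 : ‖(((1 - x) / 2 : ℝ) : ℂ) * A (u * -(1 + x))‖ ≤ (1 - x) / 2 * (64 * |u| ^ 3) := by
    rw [norm_mul, Complex.norm_real, Real.norm_of_nonneg (by linarith)]
    exact mul_le_mul_of_nonneg_left h2 (by linarith)
  have hn3 : ‖((u ^ 2 * x ^ 2 / 2 : ℝ) : ℂ)‖ = u ^ 2 * x ^ 2 / 2 := by
    rw [Complex.norm_real, Real.norm_of_nonneg (by positivity)]
  refine (norm_sub_le _ _).trans ?_
  refine (add_le_add (norm_add₃_le) le_rfl).trans ?_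
  rw [hn3]
  linarith

/-- The drift factor 1 + 1/(2k) matches √((k+1)/k) to first order, which is what makes √k the right
scale at p = 3/4. The extra factor k stands for the almost sure bound on |S k|. -/
theorem abs_one_add_half_inv_div_sqrt_sub_le {k : ℕ} (hk : 1 ≤ k) :
    |(1 + 1 / (2 * k)) / √((k : ℝ) + 1) - 1 / √(k : ℝ)| * k ≤ 1 / (k * √(k : ℝ)) := by
  have hk0 : (1 : ℝ) ≤ k := by exact_mod_cast hk
  obtain ⟨a, ha⟩ : ∃ a, a = √(k : ℝ) := ⟨_, rfl⟩
  obtain ⟨b, hb⟩ : ∃ b, b = √((k : ℝ) + 1) := ⟨_, rfl⟩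
  have ha2 : a ^ 2 = k := by rw [ha]; exact Real.sq_sqrt (by linarith)
  have hb2 : b ^ 2 = k + 1 := by rw [hb]; exact Real.sq_sqrt (by linarith)
  have hapos : 0 < a := by rw [ha]; exact Real.sqrt_pos.2 (by linarith)
  have hbpos : 0 < b := by rw [hb]; exact Real.sqrt_pos.2 (by linarith)
  have ha1 : 1 ≤ a := by nlinarith
  have hab : a ≤ b := by rw [ha, hb]; exact Real.sqrt_le_sqrt (by linarith)
  rw [← ha, ← hb, ← ha2]
  -- Since b² = a² + 1, the numerator 2a² + 1 - 2ab is a perfect square.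
  have e : (1 + 1 / (2 * a ^ 2)) / b - 1 / a = (b - a) ^ 2 / (2 * a ^ 2 * b) := by
    field_simp
    linear_combination ha2 - hb2
  have hba : b - a ≤ 1 / a := by
    rw [le_div_iff₀ hapos]; nlinarith
  rw [e, abs_of_nonneg (by positivity)]
  calc (b - a) ^ 2 / (2 * a ^ 2 * b) * a ^ 2 = (b - a) ^ 2 / (2 * b) := by field_simp
    _ ≤ (1 / a) ^ 2 / (1 * a) := by
        gcongr
        linarith
    _ = 1 / (a ^ 2 * a) := by field_simp

/-- This series dominates the accumulated one-step errors. Its term at k = 0 is 1/0 = 0, so sums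
over `Finset.range` may start there. -/
theorem summable_one_div_mul_sqrt : Summable fun k : ℕ ↦ 1 / ((k : ℝ) * √(k : ℝ)) := by
  have h := Real.summable_nat_rpow_inv.2 (show (1 : ℝ) < 3 / 2 by norm_num)
  refine h.congr fun k ↦ ?_
  rw [one_div, Real.sqrt_eq_rpow]
  congr 1
  rcases Nat.eq_zero_or_pos k with rfl | hk
  · norm_num
  · have : (0 : ℝ) < k := by exact_mod_cast hk
    rw [show (3 / 2 : ℝ) = 1 + 1 / 2 by norm_num, Real.rpow_add this, Real.rpow_one]

theorem tendsto_harmonic_div_log :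
    Tendsto (fun n : ℕ ↦ (harmonic n : ℝ) / Real.log n) atTop (𝓝 1) := by
  have hlog : Tendsto (fun n : ℕ ↦ Real.log n) atTop atTop :=
    Real.tendsto_log_atTop.comp tendsto_natCast_atTop_atTop
  have h := (Real.tendsto_harmonic_sub_log.div_atTop hlog).add_const 1
  rw [zero_add] at h
  refine h.congr' ?_
  filter_upwards [hlog.eventually_gt_atTop 0] with n hn
  field_simp
  ring

/-! ### The sign and time laws, and the position of the walk. -/

theorem ae_rademacher (r : ℝ) : ∀ᵐ x ∂rademacher r, x = 1 ∨ x = -1 := by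
  rw [rademacher, ae_add_measure_iff]
  constructor <;> refine Measure.ae_smul_measure ?_ _ <;> simp [ae_dirac_eq]

theorem integral_id_rademacher {r : ℝ} (hr : r ∈ Set.Icc (0 : ℝ) 1) :
    ∫ x, x ∂rademacher r = 2 * r - 1 := by
  rw [rademacher, integral_add_measure, integral_smul_measure, integral_smul_measure]
  · simp [ENNReal.toReal_ofReal hr.1, ENNReal.toReal_ofReal (sub_nonneg.2 hr.2)]
    ring
  · exact (integrable_dirac (by simp)).smul_measure (by simp)
  · exact (integrable_dirac (by simp)).smul_measure (by simp)

theorem measureReal_uniformOn_Icc_singleton {n j : ℕ} (hj : j ∈ Finset.Icc 1 n) :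
    (uniformOn (Set.Icc 1 n)).real {j} = (n : ℝ)⁻¹ := by
  have h := uniformOn_apply_finset (s := Finset.Icc 1 n) (t := {j})
  rw [Finset.inter_singleton_of_mem hj] at h
  simp only [Finset.coe_Icc, Finset.coe_singleton, Finset.card_singleton, Nat.card_Icc] at h
  rw [measureReal_def, h]
  simp

theorem measurable_walkPosition {Ω : Type*} [MeasurableSpace Ω] {X : ℕ → Ω → ℝ}
    (hX : ∀ n, 1 ≤ n → Measurable (X n)) (n : ℕ) : Measurable (walkPosition X n) := by
  unfold walkPosition
  exact Finset.measurable_fun_sum _ fun k hk ↦ hX k (Finset.mem_Icc.1 hk).1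

theorem walkPosition_succ {Ω : Type*} (X : ℕ → Ω → ℝ) (n : ℕ) (ω : Ω) :
    walkPosition X (n + 1) ω = walkPosition X n ω + X (n + 1) ω :=
  Finset.sum_Icc_succ_top (by omega) _

theorem walkPosition_one {Ω : Type*} (X : ℕ → Ω → ℝ) (ω : Ω) :
    walkPosition X 1 ω = X 1 ω := by
  simp [walkPosition]

/-! ### Almost sure bounds and the conditional mean of a step, for general p. -/

namespace IsElephantRandomWalk

variable {Ω : Type*} [MeasurableSpace Ω] {p q : ℝ} {X : ℕ → Ω → ℝ} {α : ℕ → Ω → ℝ}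
  {β : ℕ → Ω → ℕ} {μ : Measure Ω}

theorem ae_sign (hX : IsElephantRandomWalk p q X α β μ) {n : ℕ} (hn : 1 ≤ n) :
    ∀ᵐ ω ∂μ, α n ω = 1 ∨ α n ω = -1 :=
  ae_of_ae_map (hX.measurable_sign n hn).aemeasurable
    (by rw [hX.law_sign n hn]; exact ae_rademacher p)

theorem ae_time (hX : IsElephantRandomWalk p q X α β μ) {n : ℕ} (hn : 1 ≤ n) :
    ∀ᵐ ω ∂μ, β n ω ∈ Finset.Icc 1 n := by
  have h : ∀ᵐ k ∂μ.map (β n), k ∈ Finset.Icc 1 n := by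
    rw [hX.law_time n hn]
    simpa [uniformOn] using
      ae_cond_mem (μ := (Measure.count : Measure ℕ)) (measurableSet_Icc (a := 1) (b := n))
  exact ae_of_ae_map (hX.measurable_time n hn).aemeasurable h

/-- All exceptional null sets are discarded at once; then strong induction runs pointwise, because
`β n ω` refers back to a time in {1, …, n}. -/
theorem ae_step (hX : IsElephantRandomWalk p q X α β μ) :
    ∀ᵐ ω ∂μ, ∀ n, 1 ≤ n → X n ω = 1 ∨ X n ω = -1 := by
  have h1 : ∀ᵐ ω ∂μ, X 1 ω = 1 ∨ X 1 ω = -1 :=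
    ae_of_ae_map (hX.measurable_step 1 le_rfl).aemeasurable
      (by rw [hX.law_first]; exact ae_rademacher q)
  have hs : ∀ᵐ ω ∂μ, ∀ n, 1 ≤ n → (α n ω = 1 ∨ α n ω = -1) ∧ β n ω ∈ Finset.Icc 1 n ∧
      X (n + 1) ω = α n ω * X (β n ω) ω := by
    refine ae_all_iff.2 fun n ↦ ?_
    by_cases hn : 1 ≤ n
    · filter_upwards [hX.ae_sign hn, hX.ae_time hn, hX.step n hn] with ω a b c _ using ⟨a, b, c⟩
    · exact .of_forall fun ω h ↦ absurd h hn
  filter_upwards [h1, hs] with ω h1 hs n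
  induction n using Nat.strong_induction_on with
  | _ n ih =>
    intro hn
    obtain rfl | hn' := hn.eq_or_lt
    · exact h1
    · obtain ⟨m, rfl⟩ := Nat.exists_eq_add_of_lt hn'
      obtain ⟨a, b, c⟩ := hs (1 + m) (by omega)
      have hb := Finset.mem_Icc.1 b
      rw [c]
      rcases a with a | a <;> rcases ih (β (1 + m) ω) (by omega) hb.1 with h | h <;>
        simp [a, h]

theorem ae_abs_walkPosition_le (hX : IsElephantRandomWalk p q X α β μ) (n : ℕ) :
    ∀ᵐ ω ∂μ, |walkPosition X n ω| ≤ n := by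
  filter_upwards [hX.ae_step] with ω h
  calc |walkPosition X n ω| ≤ ∑ k ∈ Finset.Icc 1 n, |X k ω| := Finset.abs_sum_le_sum_abs _ _
    _ ≤ ∑ k ∈ Finset.Icc 1 n, 1 := Finset.sum_le_sum fun k hk ↦ by
        rcases h k (Finset.mem_Icc.1 hk).1 with h | h <;> simp [h]
    _ = n := by simp

theorem integral_sign (hX : IsElephantRandomWalk p q X α β μ) (hp : p ∈ Set.Icc (0 : ℝ) 1)
    {n : ℕ} (hn : 1 ≤ n) : ∫ ω, α n ω ∂μ = 2 * p - 1 := by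
  rw [← integral_id_rademacher hp, ← hX.law_sign n hn,
    integral_map (hX.measurable_sign n hn).aemeasurable (by fun_prop)]

theorem integral_sign_mul_indicator_time (hX : IsElephantRandomWalk p q X α β μ)
    (hp : p ∈ Set.Icc (0 : ℝ) 1) {n j : ℕ} (hj : j ∈ Finset.Icc 1 n) :
    ∫ ω, α n ω * (if β n ω = j then 1 else 0) ∂μ = (2 * p - 1) / n := by
  have hn : 1 ≤ n := by rw [Finset.mem_Icc] at hj; omega
  have hβ := hX.measurable_time n hn
  rw [(hX.indep_sign_time n hn).integral_fun_comp_mul_comp (f := fun x ↦ x)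
    (g := fun k ↦ if k = j then (1 : ℝ) else 0) (hX.measurable_sign n hn).aemeasurable
    hβ.aemeasurable (by fun_prop) (by fun_prop)]
  have h : ∫ ω, (if β n ω = j then (1 : ℝ) else 0) ∂μ = (n : ℝ)⁻¹ := by
    rw [← measureReal_uniformOn_Icc_singleton hj, ← hX.law_time n hn,
      map_measureReal_apply hβ (measurableSet_singleton j),
      ← integral_indicator_one (hβ (measurableSet_singleton j))]
    refine integral_congr_ae (.of_forall fun ω ↦ ?_)
    by_cases h : β n ω = j <;> simp [h]
  rw [h, hX.integral_sign hp hn, div_eq_mul_inv]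

/-- The conditional mean of the step `X (n + 1)` given the past is `(2 * p - 1) / n * S n`. -/
theorem integral_mul_step {𝕜 : Type*} [RCLike 𝕜] (hX : IsElephantRandomWalk p q X α β μ)
    (hp : p ∈ Set.Icc (0 : ℝ) 1) {n : ℕ} (hn : 1 ≤ n) {h : (Finset.Icc 1 n → ℝ) → 𝕜}
    (hh : Measurable h) (hint : Integrable (fun ω ↦ h (fun k ↦ X k ω)) μ) :
    ∫ ω, h (fun k ↦ X k ω) * (X (n + 1) ω : 𝕜) ∂μ =
      (((2 * p - 1) / n : ℝ) : 𝕜) * ∫ ω, h (fun k ↦ X k ω) * (walkPosition X n ω : 𝕜) ∂μ := by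
  have hα := hX.measurable_sign n hn
  have hβ := hX.measurable_time n hn
  have hXm : ∀ j : Finset.Icc 1 n, Measurable (X j) := fun j ↦
    hX.measurable_step j (Finset.mem_Icc.1 j.2).1
  have hpast : Measurable (fun ω (k : Finset.Icc 1 n) ↦ X k ω) := measurable_pi_lambda _ hXm
  have hofReal : Measurable (fun x : ℝ ↦ (x : 𝕜)) := RCLike.continuous_ofReal.measurable
  have hintX : ∀ j : Finset.Icc 1 n,
      Integrable (fun ω ↦ h (fun k ↦ X k ω) * (X j ω : 𝕜)) μ := fun j ↦ by
    refine hint.mono ((hh.comp hpast).mul (hofReal.comp (hXm j))).aestronglyMeasurable ?_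
    filter_upwards [hX.ae_step] with ω hω
    rcases hω j (Finset.mem_Icc.1 j.2).1 with e | e <;> simp [e]
  -- Splitting on the value of `β n` makes each summand a function of (α n, β n) times a function of
  -- the past, so independence factors its integral.
  have hdecomp : (fun ω ↦ h (fun k ↦ X k ω) * (X (n + 1) ω : 𝕜)) =ᵐ[μ] fun ω ↦
      ∑ j : Finset.Icc 1 n, ((α n ω * (if β n ω = (j : ℕ) then 1 else 0) : ℝ) : 𝕜) *
        (h (fun k ↦ X k ω) * (X j ω : 𝕜)) := by
    filter_upwards [hX.ae_time hn, hX.step n hn] with ω hb hs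
    rw [Finset.sum_eq_single ⟨β n ω, hb⟩]
    · simp [hs]; ring
    · rintro ⟨j, hj⟩ - hne
      have : β n ω ≠ j := fun e ↦ hne (Subtype.ext e.symm)
      simp [this]
    · simp
  have hg : ∀ j : Finset.Icc 1 n, Measurable fun x : ℝ × ℕ ↦
      ((x.1 * (if x.2 = (j : ℕ) then 1 else 0) : ℝ) : 𝕜) := fun j ↦
    hofReal.comp (measurable_fst.mul
      ((measurable_of_countable (fun k : ℕ ↦ if k = (j : ℕ) then (1 : ℝ) else 0)).comp
        measurable_snd))
  have hterm : ∀ j : Finset.Icc 1 n,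
      ∫ ω, ((α n ω * (if β n ω = (j : ℕ) then 1 else 0) : ℝ) : 𝕜) *
        (h (fun k ↦ X k ω) * (X j ω : 𝕜)) ∂μ =
      (((2 * p - 1) / n : ℝ) : 𝕜) * ∫ ω, h (fun k ↦ X k ω) * (X j ω : 𝕜) ∂μ := fun j ↦ by
    rw [← hX.integral_sign_mul_indicator_time hp j.2, ← integral_ofReal]
    exact (hX.indep_past n hn).integral_fun_comp_mul_comp
      (f := fun x : ℝ × ℕ ↦ ((x.1 * (if x.2 = (j : ℕ) then 1 else 0) : ℝ) : 𝕜))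
      (g := fun y ↦ h y * (y j : 𝕜)) (hα.prodMk hβ).aemeasurable hpast.aemeasurable
      (hg j).aestronglyMeasurable
      (hh.mul (hofReal.comp (measurable_pi_apply j))).aestronglyMeasurable
  rw [integral_congr_ae hdecomp, integral_finsetSum]
  · simp_rw [hterm]
    rw [← Finset.mul_sum, ← integral_finsetSum _ fun j _ ↦ hintX j]
    congr 2 with ω
    rw [← Finset.mul_sum, walkPosition, RCLike.ofReal_sum,
      Finset.sum_coe_sort (Finset.Icc 1 n) fun k ↦ (X k ω : 𝕜)]
  · intro j _
    refine (hintX j).mono (((hg j).comp (hα.prodMk hβ)).mul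
      ((hh.comp hpast).mul (hofReal.comp (hXm j)))).aestronglyMeasurable ?_
    filter_upwards [hX.ae_sign hn] with ω hω
    rcases hω with e | e <;> split_ifs <;> simp [e]
    all_goals positivity

variable [IsProbabilityMeasure μ]

/-- Almost surely S n lies in the compact interval [-n, n], on which f is bounded. -/
theorem integrable_comp_walkPosition (hX : IsElephantRandomWalk p q X α β μ) (n : ℕ)
    {E : Type*} [NormedAddCommGroup E] {f : ℝ → E} (hf : Continuous f) :
    Integrable (fun ω ↦ f (walkPosition X n ω)) μ := by
  obtain ⟨C, hC⟩ := isCompact_Icc.exists_bound_of_continuousOn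
    (s := Set.Icc (-(n : ℝ)) n) hf.continuousOn
  refine Integrable.of_bound (C := C) ?_ ?_
  · exact hf.comp_aestronglyMeasurable
      (measurable_walkPosition hX.measurable_step n).aestronglyMeasurable
  · filter_upwards [hX.ae_abs_walkPosition_le n] with ω hω using hC _ (abs_le.1 hω)

/-- Used over ℝ for the second moment and over ℂ for the characteristic function. -/
theorem integral_comp_walkPosition_mul_step {𝕜 : Type*} [RCLike 𝕜]
    (hX : IsElephantRandomWalk p q X α β μ) (hp : p ∈ Set.Icc (0 : ℝ) 1) {n : ℕ} (hn : 1 ≤ n)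
    {f : ℝ → 𝕜} (hf : Continuous f) :
    ∫ ω, f (walkPosition X n ω) * (X (n + 1) ω : 𝕜) ∂μ = (((2 * p - 1) / n : ℝ) : 𝕜) *
      ∫ ω, f (walkPosition X n ω) * (walkPosition X n ω : 𝕜) ∂μ := by
  have hpos : ∀ ω, walkPosition X n ω = ∑ k : Finset.Icc 1 n, X k ω := fun ω ↦ by
    rw [walkPosition, ← Finset.sum_coe_sort]
  have key := hX.integral_mul_step (𝕜 := 𝕜) hp hn (h := fun y ↦ f (∑ k, y k))
    (hf.measurable.comp (by fun_prop)) (by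
      simpa only [hpos] using hX.integrable_comp_walkPosition n hf)
  simpa only [← hpos] using key

end IsElephantRandomWalk

/-! ### Second moment and characteristic function at p = 3/4. -/

namespace IsElephantRandomWalk

variable {Ω : Type*} [MeasurableSpace Ω] {p q : ℝ} {X : ℕ → Ω → ℝ} {α : ℕ → Ω → ℝ}
  {β : ℕ → Ω → ℕ} {μ : Measure Ω} [IsProbabilityMeasure μ]

/-- The exact recursion is E (S (n+1))² = (1 + 1/n) E (S n)² + 1, whose solution has order n log n.
The weaker order n^(3/2) closes the induction easily and still gives summable errors. -/
theorem integral_sq_walkPosition_le (hX : IsElephantRandomWalk (3 / 4) q X α β μ) {n : ℕ}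
    (hn : 1 ≤ n) : ∫ ω, walkPosition X n ω ^ 2 ∂μ ≤ 2 * n * √n := by
  induction n, hn using Nat.le_induction with
  | base =>
    have h : (fun ω ↦ walkPosition X 1 ω ^ 2) =ᵐ[μ] fun _ ↦ 1 := by
      filter_upwards [hX.ae_step] with ω hω
      rw [walkPosition_one]
      rcases hω 1 le_rfl with e | e <;> simp [e]
    rw [integral_congr_ae h]
    simp
  | succ n hn ih =>
    have hn0 : (1 : ℝ) ≤ n := by exact_mod_cast hn
    have hS : Integrable (fun ω ↦ walkPosition X n ω ^ 2) μ :=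
      hX.integrable_comp_walkPosition n (f := fun x ↦ x ^ 2) (by fun_prop)
    have hS1 : Integrable (fun ω ↦ walkPosition X n ω) μ :=
      hX.integrable_comp_walkPosition n (f := fun x ↦ x) (by fun_prop)
    have hSX : Integrable (fun ω ↦ walkPosition X n ω * X (n + 1) ω) μ := by
      refine hS1.mono (hS1.aestronglyMeasurable.mul
        (hX.measurable_step (n + 1) (by omega)).aestronglyMeasurable) ?_
      filter_upwards [hX.ae_step] with ω hω
      rcases hω (n + 1) (by omega) with e | e <;> simp [e]
    have h : (fun ω ↦ walkPosition X (n + 1) ω ^ 2) =ᵐ[μ] fun ω ↦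
        walkPosition X n ω ^ 2 + (2 * (walkPosition X n ω * X (n + 1) ω) + 1) := by
      filter_upwards [hX.ae_step] with ω hω
      rw [walkPosition_succ]
      rcases hω (n + 1) (by omega) with e | e <;> rw [e] <;> ring
    have hmean := hX.integral_comp_walkPosition_mul_step (𝕜 := ℝ) (by norm_num) hn
      (f := fun x ↦ x) continuous_id
    simp only [RCLike.ofReal_real_eq_id, id_eq, ← pow_two] at hmean
    have hlin : Integrable (fun ω ↦ 2 * (walkPosition X n ω * X (n + 1) ω) + 1) μ :=
      (hSX.const_mul 2).add (integrable_const 1)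
    rw [integral_congr_ae h, integral_add hS hlin,
      integral_add (hSX.const_mul 2) (integrable_const 1), integral_const_mul, hmean]
    set I := ∫ ω, walkPosition X n ω ^ 2 ∂μ
    -- The growth of √n must absorb the additive 1 of the recursion.
    have hsq : 1 ≤ 2 * (n + 1) * (√(n + 1 : ℝ) - √n) := by
      have ha : √(n : ℝ) ^ 2 = n := Real.sq_sqrt (by linarith)
      have hb : √(n + 1 : ℝ) ^ 2 = n + 1 := Real.sq_sqrt (by linarith)
      have hb1 : 1 ≤ √(n + 1 : ℝ) := Real.one_le_sqrt.2 (by linarith)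
      have hab : √(n : ℝ) ≤ √(n + 1 : ℝ) := Real.sqrt_le_sqrt (by linarith)
      have hd : 1 = (√(n + 1 : ℝ) - √n) * (√(n + 1 : ℝ) + √n) := by linarith
      calc (1 : ℝ) = (√(n + 1 : ℝ) - √n) * (√(n + 1 : ℝ) + √n) := hd
        _ ≤ (√(n + 1 : ℝ) - √n) * (2 * (n + 1)) := by
            refine mul_le_mul_of_nonneg_left ?_ (by linarith)
            nlinarith
        _ = _ := by ring
    calc I + (2 * ((2 * (3 / 4) - 1) / n * I) + ∫ _, (1 : ℝ) ∂μ) = (1 + 1 / n) * I + 1 := by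
          simp; ring
      _ ≤ (1 + 1 / n) * (2 * n * √n) + 1 := by gcongr
      _ = 2 * (n + 1) * √n + 1 := by field_simp
      _ ≤ 2 * (n + 1) * √(n + 1) := by linarith
      _ = _ := by push_cast; rfl

/-- The characteristic function recursion of the walk. -/
theorem integral_exp_walkPosition_succ (hX : IsElephantRandomWalk (3 / 4) q X α β μ) {n : ℕ}
    (hn : 1 ≤ n) (u : ℝ) :
    ∫ ω, Complex.exp (Complex.I * (u * walkPosition X (n + 1) ω : ℝ)) ∂μ =
      ∫ ω, Complex.exp (Complex.I * (u * walkPosition X n ω : ℝ)) *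
        (Complex.cos u + Complex.I * Complex.sin u * (walkPosition X n ω / (2 * n) : ℝ)) ∂μ := by
  have hE : Continuous fun x : ℝ ↦ Complex.exp (Complex.I * (u * x : ℝ)) := by fun_prop
  have hS := hX.integrable_comp_walkPosition n hE
  have hSX : Integrable (fun ω ↦ Complex.exp (Complex.I * (u * walkPosition X n ω : ℝ)) *
      (X (n + 1) ω : ℂ)) μ := by
    refine hS.mono (hS.aestronglyMeasurable.mul (Complex.measurable_ofReal.comp
      (hX.measurable_step (n + 1) (by omega))).aestronglyMeasurable) ?_
    filter_upwards [hX.ae_step] with ω hω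
    rcases hω (n + 1) (by omega) with e | e <;> simp [e]
  have hSS := hX.integrable_comp_walkPosition n
    (f := fun x : ℝ ↦ Complex.exp (Complex.I * (u * x : ℝ)) * (x : ℂ)) (by fun_prop)
  -- As X (n+1) = ±1, exp(iu X (n+1)) = cos u + i X (n+1) sin u is affine in the step, so the
  -- conditional mean suffices.
  have h : (fun ω ↦ Complex.exp (Complex.I * (u * walkPosition X (n + 1) ω : ℝ))) =ᵐ[μ] fun ω ↦
      Complex.cos u * Complex.exp (Complex.I * (u * walkPosition X n ω : ℝ)) +
        Complex.I * Complex.sin u *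
          (Complex.exp (Complex.I * (u * walkPosition X n ω : ℝ)) * (X (n + 1) ω : ℂ)) := by
    filter_upwards [hX.ae_step] with ω hω
    have e1 : Complex.exp (Complex.I * (u * walkPosition X (n + 1) ω : ℝ)) =
        Complex.exp (Complex.I * (u * walkPosition X n ω : ℝ)) *
          Complex.exp ((u * X (n + 1) ω : ℝ) * Complex.I) := by
      rw [walkPosition_succ, ← Complex.exp_add]; congr 1; push_cast; ring
    rw [e1, Complex.exp_mul_I]
    rcases hω (n + 1) (by omega) with e | e <;> simp [e] <;> ring
  have hmean := hX.integral_comp_walkPosition_mul_step (𝕜 := ℂ) (by norm_num) hn hE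
  simp only [Complex.coe_algebraMap] at hmean
  rw [integral_congr_ae h, integral_add (hS.const_mul _) (hSX.const_mul _), integral_const_mul,
    integral_const_mul, hmean, ← integral_const_mul, ← integral_const_mul, ← integral_const_mul,
    ← integral_add (hS.const_mul _) ((hSS.const_mul _).const_mul _)]
  congr 1 with ω
  push_cast
  ring

/-- The constant is 67 = 65 + 1 + 1: the cubic error of the centred sign, the change of scale to
τ/√n, and the second-moment term. -/
theorem norm_integral_exp_walkPosition_succ_sub_le
    (hX : IsElephantRandomWalk (3 / 4) q X α β μ) {n : ℕ} (hn : 1 ≤ n) {τ : ℝ} (hτ : |τ| ≤ 1) :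
    ‖∫ ω, Complex.exp (Complex.I * (τ / √(n + 1 : ℝ) * walkPosition X (n + 1) ω : ℝ)) ∂μ -
      Complex.exp (-((τ / √(n + 1 : ℝ) : ℝ) : ℂ) ^ 2 / 2) *
        ∫ ω, Complex.exp (Complex.I * (τ / √(n : ℝ) * walkPosition X n ω : ℝ)) ∂μ‖ ≤
      67 * |τ| * (1 / (n * √(n : ℝ))) := by
  have hn0 : (1 : ℝ) ≤ n := by exact_mod_cast hn
  have hs1 : 1 ≤ √(n : ℝ) := Real.one_le_sqrt.2 hn0
  have hs : √(n : ℝ) ≤ √(n + 1 : ℝ) := Real.sqrt_le_sqrt (by linarith)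
  have hsq : √(n : ℝ) ^ 2 = n := Real.sq_sqrt (by linarith)
  set u : ℝ := τ / √(n + 1 : ℝ) with hu
  set v : ℝ := τ / √(n : ℝ) with hv
  have hu_le : |u| ≤ |τ| / √(n : ℝ) := by
    rw [hu, abs_div, abs_of_nonneg (Real.sqrt_nonneg _)]
    exact div_le_div_of_nonneg_left (abs_nonneg τ) (by linarith) hs
  have hu1 : |u| ≤ 1 := hu_le.trans (by rw [div_le_one (by linarith)]; linarith)
  have hτ3 : |τ| ^ 3 ≤ |τ| := by
    simpa using pow_le_pow_of_le_one (abs_nonneg τ) hτ (show 1 ≤ 3 by norm_num)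
  have hτ2 : |τ| ^ 2 ≤ |τ| := by
    simpa using pow_le_pow_of_le_one (abs_nonneg τ) hτ (show 1 ≤ 2 by norm_num)
  have hu3 : |u| ^ 3 ≤ |τ| * (1 / (n * √(n : ℝ))) := by
    calc |u| ^ 3 ≤ (|τ| / √(n : ℝ)) ^ 3 := by gcongr
      _ = |τ| ^ 3 * (1 / (n * √(n : ℝ))) := by
          rw [div_pow, show √(n : ℝ) ^ 3 = √(n : ℝ) ^ 2 * √n by ring, hsq]; ring
      _ ≤ _ := by gcongr
  have hu2 : u ^ 2 / √(n : ℝ) ≤ |τ| * (1 / (n * √(n : ℝ))) := by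
    calc u ^ 2 / √(n : ℝ) = |u| ^ 2 / √(n : ℝ) := by rw [sq_abs]
      _ ≤ (|τ| / √(n : ℝ)) ^ 2 / √(n : ℝ) := by gcongr
      _ = |τ| ^ 2 * (1 / (n * √(n : ℝ))) := by rw [div_pow, hsq]; field_simp
      _ ≤ _ := by gcongr
  set g : ℂ := Complex.exp (-(u : ℂ) ^ 2 / 2) with hg
  have hg1 : ‖g‖ ≤ 1 := by
    rw [hg, show -(u : ℂ) ^ 2 / 2 = ((-u ^ 2 / 2 : ℝ) : ℂ) by push_cast; ring,
      Complex.norm_exp_ofReal, Real.exp_le_one_iff]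
    nlinarith [sq_nonneg u]
  have hint : Integrable (fun ω ↦ Complex.exp (Complex.I * (v * walkPosition X n ω : ℝ))) μ :=
    hX.integrable_comp_walkPosition n
      (f := fun x : ℝ ↦ Complex.exp (Complex.I * (v * x : ℝ))) (by fun_prop)
  have hint' : Integrable (fun ω ↦ Complex.exp (Complex.I * (u * walkPosition X n ω : ℝ)) *
      (Complex.cos u + Complex.I * Complex.sin u * (walkPosition X n ω / (2 * n) : ℝ))) μ :=
    hX.integrable_comp_walkPosition n (f := fun x : ℝ ↦ Complex.exp (Complex.I * (u * x : ℝ)) *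
      (Complex.cos u + Complex.I * Complex.sin u * (x / (2 * n) : ℝ))) (by fun_prop)
  have hS2 : Integrable (fun ω ↦ walkPosition X n ω ^ 2) μ :=
    hX.integrable_comp_walkPosition n (f := fun x ↦ x ^ 2) (by fun_prop)
  rw [hX.integral_exp_walkPosition_succ hn, ← integral_const_mul,
    ← integral_sub hint' (hint.const_mul g)]
  have hpt : ∀ᵐ ω ∂μ, ‖Complex.exp (Complex.I * (u * walkPosition X n ω : ℝ)) *
      (Complex.cos u + Complex.I * Complex.sin u * (walkPosition X n ω / (2 * n) : ℝ)) -
        g * Complex.exp (Complex.I * (v * walkPosition X n ω : ℝ))‖ ≤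
      u ^ 2 / (8 * n ^ 2) * walkPosition X n ω ^ 2 +
        66 * (|τ| * (1 / (n * √(n : ℝ)))) := by
    filter_upwards [hX.ae_abs_walkPosition_le n] with ω hω
    set S := walkPosition X n ω
    have hx : |S / (2 * n)| ≤ 1 := by
      rw [abs_div, abs_of_nonneg (by positivity : (0 : ℝ) ≤ 2 * n), div_le_one (by positivity)]
      linarith
    -- The frequency once the drift S/(2n) is absorbed; it differs from v only slightly.
    set w : ℝ := u * (1 + 1 / (2 * n)) with hw
    have hsplit : Complex.exp (Complex.I * (u * S : ℝ)) *
        (Complex.cos u + Complex.I * Complex.sin u * (S / (2 * n) : ℝ)) -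
          g * Complex.exp (Complex.I * (v * S : ℝ)) =
        Complex.exp (Complex.I * (w * S : ℝ)) *
          (Complex.exp (Complex.I * (-(u * (S / (2 * n))) : ℝ)) *
            (Complex.cos u + Complex.I * Complex.sin u * (S / (2 * n) : ℝ)) - g) +
        g * Complex.exp (Complex.I * (v * S : ℝ)) *
          (Complex.exp (Complex.I * ((w - v) * S : ℝ)) - 1) := by
      have e1 : Complex.exp (Complex.I * (u * S : ℝ)) = Complex.exp (Complex.I * (w * S : ℝ)) *
          Complex.exp (Complex.I * (-(u * (S / (2 * n))) : ℝ)) := by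
        rw [← Complex.exp_add, ← mul_add, ← Complex.ofReal_add]
        congr 3
        rw [hw]; ring
      have e2 : Complex.exp (Complex.I * (w * S : ℝ)) = Complex.exp (Complex.I * (v * S : ℝ)) *
          Complex.exp (Complex.I * ((w - v) * S : ℝ)) := by
        rw [← Complex.exp_add, ← mul_add, ← Complex.ofReal_add]
        congr 3
        ring
      rw [e1, e2]; ring
    have hunit : ∀ y : ℝ, ‖Complex.exp (Complex.I * (y : ℂ))‖ = 1 := Complex.norm_exp_I_mul_ofReal
    rw [hsplit]
    refine (norm_add_le _ _).trans ?_
    rw [norm_mul, norm_mul, norm_mul, hunit, hunit, one_mul, mul_one]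
    have h1 := norm_charFun_centred_sign_sub_le hx hu1
    have h2 : ‖Complex.exp (Complex.I * ((w - v) * S : ℝ)) - 1‖ ≤
        |τ| * (1 / (n * √(n : ℝ))) := by
      refine Real.norm_exp_I_mul_ofReal_sub_one_le.trans ?_
      have hwv : w - v = τ * ((1 + 1 / (2 * n)) / √(n + 1 : ℝ) - 1 / √(n : ℝ)) := by
        rw [hw, hu, hv]; ring
      rw [Real.norm_eq_abs, abs_mul, hwv, abs_mul, mul_assoc]
      refine mul_le_mul_of_nonneg_left ?_ (abs_nonneg τ)
      exact (mul_le_mul_of_nonneg_left hω (abs_nonneg _)).trans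
        (abs_one_add_half_inv_div_sqrt_sub_le hn)
    have h3 : ‖g‖ * ‖Complex.exp (Complex.I * ((w - v) * S : ℝ)) - 1‖ ≤
        |τ| * (1 / (n * √(n : ℝ))) :=
      (mul_le_of_le_one_left (norm_nonneg _) hg1).trans h2
    have h4 : u ^ 2 * (S / (2 * n)) ^ 2 / 2 = u ^ 2 / (8 * n ^ 2) * S ^ 2 := by
      field_simp; norm_num
    linarith
  refine (norm_integral_le_of_norm_le ((hS2.const_mul _).add (integrable_const _)) hpt).trans ?_
  rw [integral_add' (hS2.const_mul _) (integrable_const _), integral_const_mul]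
  have h5 : u ^ 2 / (8 * n ^ 2) * ∫ ω, walkPosition X n ω ^ 2 ∂μ ≤
      |τ| * (1 / (n * √(n : ℝ))) := by
    calc _ ≤ u ^ 2 / (8 * n ^ 2) * (2 * n * √n) := by
          gcongr
          exact hX.integral_sq_walkPosition_le hn
      _ = u ^ 2 / √(n : ℝ) * (√(n : ℝ) ^ 2 / (4 * n)) := by field_simp; ring
      _ = u ^ 2 / √(n : ℝ) * (1 / 4) := by rw [hsq]; field_simp
      _ ≤ u ^ 2 / √(n : ℝ) := by
          have : 0 ≤ u ^ 2 / √(n : ℝ) := by positivity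
          linarith
      _ ≤ _ := hu2
  simp only [integral_const, probReal_univ, one_smul]
  linarith

/-- Each Gaussian factor has norm at most 1, so earlier errors are never amplified and simply add
up. The recursion starts at n = 1, hence H_n - 1; replacing S 1 by 0 costs the initial |τ|. -/
theorem norm_integral_exp_walkPosition_sub_le (hX : IsElephantRandomWalk (3 / 4) q X α β μ)
    {n : ℕ} (hn : 1 ≤ n) {τ : ℝ} (hτ : |τ| ≤ 1) :
    ‖∫ ω, Complex.exp (Complex.I * (τ / √(n : ℝ) * walkPosition X n ω : ℝ)) ∂μ -
      Complex.exp ((-(τ ^ 2 * ((harmonic n : ℝ) - 1) / 2) : ℝ) : ℂ)‖ ≤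
      |τ| * (1 + 67 * ∑ k ∈ Finset.range n, 1 / ((k : ℝ) * √(k : ℝ))) := by
  induction n, hn using Nat.le_induction with
  | base =>
    have hint := hX.integrable_comp_walkPosition 1
      (f := fun x : ℝ ↦ Complex.exp (Complex.I * (τ / √((1 : ℕ) : ℝ) * x : ℝ))) (by fun_prop)
    have e : (-(τ ^ 2 * (((harmonic 1 : ℚ) : ℝ) - 1) / 2) : ℝ) = 0 := by simp [harmonic]
    have e1 : (1 : ℂ) = ∫ _, (1 : ℂ) ∂μ := by simp
    rw [e, Complex.ofReal_zero, Complex.exp_zero, e1, ← integral_sub hint (integrable_const _)]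
    refine (norm_integral_le_of_norm_le_const (C := |τ|) ?_).trans (by simp)
    filter_upwards [hX.ae_abs_walkPosition_le 1] with ω hω
    refine Real.norm_exp_I_mul_ofReal_sub_one_le.trans ?_
    rw [Real.norm_eq_abs, abs_mul]
    simp only [Nat.cast_one, Real.sqrt_one, div_one] at hω ⊢
    exact mul_le_of_le_one_right (abs_nonneg τ) hω
  | succ n hn ih =>
    have hstep := hX.norm_integral_exp_walkPosition_succ_sub_le hn hτ
    set u : ℝ := τ / √(n + 1 : ℝ) with hu
    set g : ℂ := Complex.exp (-(u : ℂ) ^ 2 / 2) with hg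
    have hg1 : ‖g‖ ≤ 1 := by
      rw [hg, show -(u : ℂ) ^ 2 / 2 = ((-u ^ 2 / 2 : ℝ) : ℂ) by push_cast; ring,
        Complex.norm_exp_ofReal, Real.exp_le_one_iff]
      nlinarith [sq_nonneg u]
    have hexp : Complex.exp ((-(τ ^ 2 * ((harmonic (n + 1) : ℝ) - 1) / 2) : ℝ) : ℂ) =
        g * Complex.exp ((-(τ ^ 2 * ((harmonic n : ℝ) - 1) / 2) : ℝ) : ℂ) := by
      rw [hg, show -(u : ℂ) ^ 2 / 2 = ((-u ^ 2 / 2 : ℝ) : ℂ) by push_cast; ring,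
        ← Complex.exp_add, ← Complex.ofReal_add, harmonic_succ, hu, div_pow,
        Real.sq_sqrt (by positivity)]
      congr 2
      push_cast
      field_simp
      ring
    rw [hexp, Finset.sum_range_succ, Nat.cast_succ]
    set a := ∫ ω, Complex.exp (Complex.I * (u * walkPosition X (n + 1) ω : ℝ)) ∂μ
    set b := ∫ ω, Complex.exp (Complex.I * (τ / √(n : ℝ) * walkPosition X n ω : ℝ)) ∂μ
    set c := Complex.exp ((-(τ ^ 2 * ((harmonic n : ℝ) - 1) / 2) : ℝ) : ℂ)
    calc ‖a - g * c‖ = ‖(a - g * b) + g * (b - c)‖ := by congr 1; ring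
      _ ≤ ‖a - g * b‖ + ‖g‖ * ‖b - c‖ := by
          rw [← norm_mul]; exact norm_add_le _ _
      _ ≤ 67 * |τ| * (1 / (n * √(n : ℝ))) + ‖b - c‖ :=
          add_le_add hstep (mul_le_of_le_one_left (norm_nonneg _) hg1)
      _ ≤ _ := by linarith

end IsElephantRandomWalk

/-! ### Passage to the limit. -/

theorem theorem3p6 {Ω : Type*} [MeasurableSpace Ω] (μ : Measure Ω) [IsProbabilityMeasure μ]
    (q : ℝ) (hq : q ∈ Set.Icc (0 : ℝ) 1)
    (X : ℕ → Ω → ℝ) (α : ℕ → Ω → ℝ) (β : ℕ → Ω → ℕ)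
    (hX : IsElephantRandomWalk (3 / 4) q X α β μ) :
    TendstoInDistribution
      (fun (n : ℕ) (ω : Ω) ↦ walkPosition X n ω / Real.sqrt ((n : ℝ) * Real.log (n : ℝ)))
      atTop (id : ℝ → ℝ) (fun _ ↦ μ) (gaussianReal 0 1) := by
  have hmeas : ∀ n : ℕ, Measurable fun ω ↦
      walkPosition X n ω / Real.sqrt ((n : ℝ) * Real.log (n : ℝ)) := fun n ↦
    (measurable_walkPosition hX.measurable_step n).div_const _
  refine ⟨fun n ↦ (hmeas n).aemeasurable, aemeasurable_id, ?_⟩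
  refine ProbabilityMeasure.tendsto_iff_tendsto_charFun.2 fun t ↦ ?_
  simp only [ProbabilityMeasure.coe_mk, Measure.map_id, charFun_gaussianReal]
  have hlog : Tendsto (fun n : ℕ ↦ Real.log n) atTop atTop :=
    Real.tendsto_log_atTop.comp tendsto_natCast_atTop_atTop
  -- With this choice t S n / √(n log n) = τ n S n / √n, and τ n → 0 kills the uniform error bound.
  set τ : ℕ → ℝ := fun n ↦ t / √(Real.log n) with hτ
  have hτ0 : Tendsto (fun n ↦ |τ n|) atTop (𝓝 0) := by
    rw [← abs_zero]
    exact (tendsto_const_nhds.div_atTop (Real.tendsto_sqrt_atTop.comp hlog)).abs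
  have hvar : Tendsto (fun n : ℕ ↦ τ n ^ 2 * ((harmonic n : ℝ) - 1) / 2) atTop
      (𝓝 (t ^ 2 / 2)) := by
    have h := ((tendsto_harmonic_div_log.sub hlog.inv_tendsto_atTop).const_mul (t ^ 2)).div_const 2
    rw [sub_zero, mul_one] at h
    refine h.congr' ?_
    filter_upwards [hlog.eventually_gt_atTop 0] with n hn
    simp only [hτ, div_pow, Real.sq_sqrt hn.le, Pi.inv_apply]
    field_simp
  have hgauss : Tendsto
      (fun n : ℕ ↦ Complex.exp ((-(τ n ^ 2 * ((harmonic n : ℝ) - 1) / 2) : ℝ) : ℂ)) atTop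
      (𝓝 (Complex.exp ((-(t ^ 2 / 2) : ℝ) : ℂ))) :=
    ((Complex.continuous_exp.comp Complex.continuous_ofReal).tendsto _).comp hvar.neg
  have hchar : ∀ᶠ n : ℕ in atTop,
      charFun (μ.map fun ω ↦ walkPosition X n ω / Real.sqrt ((n : ℝ) * Real.log (n : ℝ))) t =
        ∫ ω, Complex.exp (Complex.I * (τ n / √(n : ℝ) * walkPosition X n ω : ℝ)) ∂μ := by
    refine .of_forall fun n ↦ ?_
    rw [charFun_apply_real, integral_map (hmeas n).aemeasurable (by fun_prop)]
    congr 1 with ω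
    rw [Real.sqrt_mul (by positivity), hτ]
    congr 1
    push_cast
    ring
  have hbound : ∀ᶠ n : ℕ in atTop,
      ‖charFun (μ.map fun ω ↦ walkPosition X n ω / Real.sqrt ((n : ℝ) * Real.log (n : ℝ))) t -
        Complex.exp ((-(τ n ^ 2 * ((harmonic n : ℝ) - 1) / 2) : ℝ) : ℂ)‖ ≤
      |τ n| * (1 + 67 * ∑' k : ℕ, 1 / ((k : ℝ) * √(k : ℝ))) := by
    filter_upwards [hchar, hτ0.eventually_le_const one_pos, eventually_ge_atTop 1] with n h1 h2 h3
    rw [h1]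
    refine (hX.norm_integral_exp_walkPosition_sub_le h3 h2).trans ?_
    gcongr
    exact summable_one_div_mul_sqrt.sum_le_tsum _ fun k _ ↦ by positivity
  have hdiff := squeeze_zero_norm' hbound (by simpa using hτ0.mul_const _)
  have h := hdiff.add hgauss
  simp only [sub_add_cancel, zero_add] at h
  convert h using 3
  simp
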